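/- **Corollary.** Let $n \ge 7$ and let $P \subset \mathbb{R}^2$ be a convex $n$-gon, i.e. the closed region bounded by a convex polygon with exactly $n$ vertices, all of whose interior angles are strictly less than $\pi$. Then $P$ does not admit a tessellation of the Euclidean plane: there is no collection $\mathcal{T}$ of subsets of $\mathbb{R}^2$ such that every $T \in \mathcal{T}$ is a copy of $P$ (the image of $P$ under an isometry of the plane, reflections allowed), $\bigcup_{T\in\mathcal{T}} T = \mathbb{R}^2$, and the interiors of any two distinct members of $\mathcal{T}$ are disjoint. The tiles are not required to meet edge to edge. -/

import Mathlib

/-- The Euclidean plane. -/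
abbrev Plane : Type := EuclideanSpace ℝ (Fin 2)

/-- The cyclically ordered points `poly 0, …, poly (n - 1)` are the consecutive vertices of a
convex `n`-gon: there are at least three of them, consecutive ones are distinct, and for each side
the vertices that are not endpoints of it all lie strictly on one side of the line through it.
In particular the angle at every vertex is strictly less than `π`, so that the polygon has exactly
`n` corners and `n` sides. -/
structure IsConvexPolygon {n : ℕ} (poly : Polygon Plane n) : Prop where
  three_le : 3 ≤ n
  hasNondegenerateEdges : poly.HasNondegenerateEdges
  sSameSide : ∀ i j k : Fin n, j ≠ i → j ≠ finRotate n i → k ≠ i → k ≠ finRotate n i →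
    (line[ℝ, poly i, poly (finRotate n i)]).SSameSide (poly j) (poly k)

/-- The closed region bounded by a convex polygon. -/
def Polygon.region {n : ℕ} (poly : Polygon Plane n) : Set Plane :=
  convexHull ℝ (Set.range poly.vertices)

/-- `T` is a copy of `S`: it is the image of `S` under an isometry of the plane, which may be
orientation reversing. -/
def IsCopyOf (T S : Set Plane) : Prop :=
  ∃ g : Plane ≃ᵃⁱ[ℝ] Plane, T = g '' S

/-- The collection `𝒯` of sets is a tessellation of the plane by copies of `tile`: its members are
copies of `tile`, they cover the plane (no gaps), and distinct members have disjoint interiors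
(no overlaps). Tiles need not meet edge to edge. -/
structure IsTessellation (tile : Set Plane) (𝒯 : Set (Set Plane)) : Prop where
  isCopyOf : ∀ T ∈ 𝒯, IsCopyOf T tile
  sUnion_eq : ⋃₀ 𝒯 = Set.univ
  disjoint_interior : ∀ T ∈ 𝒯, ∀ T' ∈ 𝒯, T ≠ T' → Disjoint (interior T) (interior T')

/-- `tile` admits a tessellation of the plane. -/
def AdmitsTessellation (tile : Set Plane) : Prop :=
  ∃ 𝒯 : Set (Set Plane), IsTessellation tile 𝒯

/-! Measure angles in full turns. The interior angles of a convex `n`-gon sum to `n / 2 - 1`, so for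
`n ≥ 7` their average exceeds `1 / 3`. In a tessellation, however, the corners that meet at a point
average at most `1 / 3`: each is below `1 / 2`, every other tile through the point takes up `1 / 2`
or `1`, and the total is `1` (`sum_le_card_div_three`). Sum `1 / 3 - angle` over all tile corners in
a disk of radius `R`. Grouped by points, the sum is nonnegative (`IsTessellation.sum_ball_nonneg`).
Grouped by tiles, each tile inside the disk contributes at most `1 - n / 6 ≤ -1 / 6`, and each other
tile that meets the disk at most `n / 3`. Hence the inner tiles are at most a constant times the
boundary tiles (`IsTessellation.card_le`). Comparing areas, the former grow like `R ^ 2` and the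
latter like `R`, a contradiction. Angles enter only as area densities (`HasDensity`). These add up
over the tiles at a point because overlaps are null (`IsTessellation.sum_density`), so no edge or
incidence structure is needed. Only a lower bound for the angle sum is used (`sum_sectorDensity`);
it comes from the disjointness of the outer normal cones at the vertices. -/

open Set Filter Topology MeasureTheory Metric Module
open scoped Pointwise

/-! ### Signed area and linear algebra in the plane. -/

/-- The signed area of the parallelogram spanned by two vectors of the plane. -/
def cross (a b : Plane) : ℝ := a 0 * b 1 - a 1 * b 0

lemma cross_same (a : Plane) : cross a a = 0 := by simp only [cross]; ring

lemma cross_swap (a b : Plane) : cross b a = -cross a b := by simp only [cross]; ring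

lemma cross_add_right (a x y : Plane) : cross a (x + y) = cross a x + cross a y := by
  simp only [cross, PiLp.add_apply]; ring

lemma cross_smul_right (a : Plane) (t : ℝ) (x : Plane) : cross a (t • x) = t * cross a x := by
  simp only [cross, PiLp.smul_apply, smul_eq_mul]; ring

lemma cross_smul_left (t : ℝ) (a x : Plane) : cross (t • a) x = t * cross a x := by
  simp only [cross, PiLp.smul_apply, smul_eq_mul]; ring

lemma cross_add_left (a b x : Plane) : cross (a + b) x = cross a x + cross b x := by
  simp only [cross, PiLp.add_apply]; ring

lemma cross_sub_right (a x y : Plane) : cross a (x - y) = cross a x - cross a y := by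
  simp only [cross, PiLp.sub_apply]; ring

lemma cross_neg_right (a x : Plane) : cross a (-x) = -cross a x := by
  simp only [cross, PiLp.neg_apply]; ring

lemma continuous_cross_right (a : Plane) : Continuous (cross a) := by
  unfold cross; fun_prop

lemma continuous_cross_left (b : Plane) : Continuous fun x => cross x b := by
  unfold cross; fun_prop

/-- Cramer's rule in the plane. -/
lemma cramer (a b x : Plane) : cross a b • x = cross x b • a + cross a x • b := by
  ext i; fin_cases i <;> simp [cross] <;> ring

lemma eq_of_cross_ne_zero {a b : Plane} (h : cross a b ≠ 0) (x : Plane) :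
    x = (cross x b / cross a b) • a + (cross a x / cross a b) • b := by
  have := cramer a b x
  rw [div_eq_inv_mul, div_eq_inv_mul, mul_smul, mul_smul, ← smul_add, ← this, smul_smul,
    inv_mul_cancel₀ h, one_smul]

lemma exists_smul_eq_of_cross_eq_zero {a b : Plane} (ha : a ≠ 0) (h : cross a b = 0) :
    ∃ t : ℝ, b = t • a := by
  simp only [cross] at h
  have hn : a 0 ^ 2 + a 1 ^ 2 ≠ 0 := by
    intro h0
    apply ha
    have h1 : a 0 = 0 := by nlinarith [sq_nonneg (a 0), sq_nonneg (a 1)]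
    have h2 : a 1 = 0 := by nlinarith [sq_nonneg (a 0), sq_nonneg (a 1)]
    ext i; fin_cases i <;> simp [h1, h2]
  refine ⟨(a 0 * b 0 + a 1 * b 1) / (a 0 ^ 2 + a 1 ^ 2), ?_⟩
  ext i
  fin_cases i
  · simp; field_simp; linear_combination (-a 1) * h
  · simp; field_simp; linear_combination (a 0) * h

/-- Rotation of the plane by a right angle. -/
noncomputable def quarterTurn : Plane ≃ₗᵢ[ℝ] Plane where
  toFun x := !₂[-x 1, x 0]
  invFun x := !₂[x 1, -x 0]
  map_add' x y := by ext i; fin_cases i <;> simp; ring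
  map_smul' t x := by ext i; fin_cases i <;> simp
  left_inv x := by ext i; fin_cases i <;> simp
  right_inv x := by ext i; fin_cases i <;> simp
  norm_map' x := by
    simp [EuclideanSpace.norm_eq, Fin.sum_univ_two, add_comm]

lemma inner_quarterTurn (x a : Plane) : inner ℝ (quarterTurn x) a = -cross a x := by
  have : quarterTurn x = !₂[-x 1, x 0] := rfl
  simp [this, cross, PiLp.inner_apply, Fin.sum_univ_two]; ring

/-! ### Area density at a point, as a substitute for angle. -/

/-- The set `S` has density `d` at `p`: small disks around `p` meet `S` in the proportion `d` of
their area. -/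
def HasDensity (S : Set Plane) (p : Plane) (d : ℝ) : Prop :=
  ∀ᶠ r in 𝓝[>] (0 : ℝ), volume.real (S ∩ ball p r) = d * volume.real (ball p r)

/-- The closed convex cone spanned by two positively oriented vectors. -/
def sector (a b : Plane) : Set Plane := {x | 0 ≤ cross a x ∧ 0 ≤ cross x b}

lemma eventually_ball_of_nhds {p : Plane} {q : Plane → Prop} (h : ∀ᶠ x in 𝓝 p, q x) :
    ∀ᶠ r in 𝓝[>] (0 : ℝ), ∀ x ∈ ball p r, q x := by
  obtain ⟨ε, hε, hb⟩ := Metric.eventually_nhds_iff_ball.1 h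
  filter_upwards [Ioo_mem_nhdsGT hε] with r hr x hx
  exact hb x (ball_subset_ball hr.2.le hx)

lemma HasDensity.congr {S S' : Set Plane} {p : Plane} {d : ℝ} (h : HasDensity S p d)
    (hS : ∀ᶠ x in 𝓝 p, x ∈ S' ↔ x ∈ S) : HasDensity S' p d := by
  filter_upwards [h, eventually_ball_of_nhds hS] with r h1 h2
  rw [← h1]
  congr 1
  ext x
  exact and_congr_left fun hx => h2 x hx

lemma volume_real_ball_pos (p : Plane) {r : ℝ} (hr : 0 < r) : 0 < volume.real (ball p r) :=
  ENNReal.toReal_pos (measure_ball_pos _ _ hr).ne' measure_ball_lt_top.ne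

lemma volume_real_ball (p : Plane) {r : ℝ} (hr : 0 ≤ r) :
    volume.real (ball p r) = r ^ 2 * volume.real (ball (0 : Plane) 1) := by
  rw [measureReal_def, Measure.addHaar_ball _ _ hr, ENNReal.toReal_mul,
    ENNReal.toReal_ofReal (by positivity), finrank_euclideanSpace_fin, measureReal_def]

lemma hasDensity_of_mem_nhds {S : Set Plane} {p : Plane} (h : S ∈ 𝓝 p) : HasDensity S p 1 := by
  filter_upwards [eventually_ball_of_nhds h] with r hr
  rw [one_mul, inter_eq_right.2 hr]

/-- Scaling by `r` carries the part of a cone in the unit disk to its part in the disk of radius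
`r`, so the proportion does not depend on the radius. -/
lemma hasDensity_of_cone {K : Set Plane} (hK : ∀ t : ℝ, 0 < t → ∀ x, t • x ∈ K ↔ x ∈ K) :
    HasDensity K 0 (volume.real (K ∩ ball 0 1) / volume.real (ball (0 : Plane) 1)) := by
  filter_upwards [self_mem_nhdsWithin] with r (hr : 0 < r)
  have : K ∩ ball 0 r = r • (K ∩ ball 0 1) := by
    ext x
    rw [mem_smul_set_iff_inv_smul_mem₀ hr.ne']
    simp only [mem_inter_iff, hK _ (inv_pos.2 hr), mem_ball_zero_iff, norm_smul, norm_inv,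
      Real.norm_of_nonneg hr.le]
    rw [inv_mul_lt_iff₀ hr, mul_one]
  rw [this, volume_real_ball 0 hr.le, measureReal_def, Measure.addHaar_smul_of_nonneg _ hr.le,
    ENNReal.toReal_mul, ENNReal.toReal_ofReal (by positivity), finrank_euclideanSpace_fin,
    ← measureReal_def]
  have := (volume_real_ball_pos (0 : Plane) one_pos).ne'
  field_simp

lemma measurePreserving_affineIsometryEquiv (g : Plane ≃ᵃⁱ[ℝ] Plane) :
    MeasurePreserving g volume volume := by
  have : (g : Plane → Plane) = (fun x => x + g 0) ∘ g.linearIsometryEquiv := by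
    ext1 x
    have := g.map_vadd 0 x
    simpa using this
  rw [this]
  exact (measurePreserving_add_right volume _).comp g.linearIsometryEquiv.measurePreserving

lemma volume_image_affineIsometryEquiv (g : Plane ≃ᵃⁱ[ℝ] Plane) (S : Set Plane) :
    volume (g '' S) = volume S := by
  have h := (measurePreserving_affineIsometryEquiv g.symm).measure_preimage_emb
    g.symm.toHomeomorph.measurableEmbedding S
  rw [← h]
  congr 1
  exact g.toEquiv.image_eq_preimage_symm S

lemma HasDensity.image {S : Set Plane} {p : Plane} {d : ℝ} (h : HasDensity S p d)
    (g : Plane ≃ᵃⁱ[ℝ] Plane) : HasDensity (g '' S) (g p) d := by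
  filter_upwards [h] with r hr
  have hb : ball (g p) r = g '' ball p r := (g.toIsometryEquiv.image_ball p r).symm
  rw [hb, ← image_inter g.injective, measureReal_def, measureReal_def,
    volume_image_affineIsometryEquiv, volume_image_affineIsometryEquiv]
  exact hr

lemma HasDensity.vadd {S S' : Set Plane} {p : Plane} {d : ℝ} (h : HasDensity S 0 d)
    (hS : ∀ᶠ x in 𝓝 0, p + x ∈ S' ↔ x ∈ S) : HasDensity S' p d := by
  have h1 := h.image (AffineIsometryEquiv.constVAdd ℝ Plane p)
  simp only [AffineIsometryEquiv.coe_constVAdd, vadd_eq_add, add_zero] at h1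
  refine h1.congr ?_
  have h2 : Tendsto (fun y : Plane => -p + y) (𝓝 p) (𝓝 0) := by
    have : Continuous fun y : Plane => -p + y := by fun_prop
    simpa using this.tendsto p
  filter_upwards [h2.eventually hS] with y hy
  rw [add_neg_cancel_left] at hy
  rw [hy]
  simp

/-! ### Half-planes, sectors and their normal cones. -/

lemma volume_cross_eq_zero {a : Plane} (ha : a ≠ 0) :
    volume {x : Plane | cross a x = 0} = 0 := by
  have : {x : Plane | cross a x = 0} ⊆ (ℝ ∙ a : Submodule ℝ Plane) := by
    intro x hx
    obtain ⟨t, rfl⟩ := exists_smul_eq_of_cross_eq_zero ha hx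
    exact Submodule.smul_mem _ _ (Submodule.mem_span_singleton_self a)
  refine measure_mono_null this (Measure.addHaar_submodule _ _ ?_)
  intro h
  have h1 := finrank_span_singleton (K := ℝ) ha
  rw [h, finrank_top, finrank_euclideanSpace_fin] at h1
  norm_num at h1

/-- The map `x ↦ -x` exchanges the two closed half-planes, which overlap in a null line. -/
lemma volume_real_halfPlane {a : Plane} (ha : a ≠ 0) :
    volume.real ({x : Plane | 0 ≤ cross a x} ∩ ball 0 1)
      = 1 / 2 * volume.real (ball (0 : Plane) 1) := by
  set A : Set Plane := {x : Plane | 0 ≤ cross a x} ∩ ball 0 1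
  set A' : Set Plane := {x : Plane | cross a x ≤ 0} ∩ ball 0 1
  have hA' : volume.real A' = volume.real A := by
    have : A' = Neg.neg ⁻¹' A := by
      ext x; simp [A, A', cross_neg_right]
    rw [this, measureReal_def, measureReal_def]
    congr 1
    exact Measure.measure_preimage_neg _ _
  have hm : MeasurableSet A' :=
    (measurableSet_le (continuous_cross_right a).measurable measurable_const).inter
      measurableSet_ball
  have hu : A ∪ A' = ball 0 1 := by
    rw [← union_inter_distrib_right, inter_eq_right]
    intro x _
    exact le_total 0 (cross a x)
  have hn : volume.real (A ∩ A') = 0 := by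
    rw [measureReal_eq_zero_iff (measure_ne_top_of_subset (s := ball (0 : Plane) 1)
      (fun x hx => hx.1.2) measure_ball_lt_top.ne)]
    exact measure_mono_null (fun x hx => le_antisymm hx.2.1 hx.1.1) (volume_cross_eq_zero ha)
  have := measureReal_union_add_inter (μ := volume) (s := A) hm
    (measure_ne_top_of_subset inter_subset_right measure_ball_lt_top.ne)
    (measure_ne_top_of_subset inter_subset_right measure_ball_lt_top.ne)
  rw [hu, hn, hA'] at this
  linarith

lemma hasDensity_halfPlane {a : Plane} (ha : a ≠ 0) :
    HasDensity {x : Plane | 0 ≤ cross a x} 0 (1 / 2) := by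
  have h := hasDensity_of_cone (K := {x : Plane | 0 ≤ cross a x}) fun t ht x => by
    simp [cross_smul_right, ht]
  rw [volume_real_halfPlane ha,
    mul_div_cancel_right₀ _ (volume_real_ball_pos (0 : Plane) one_pos).ne'] at h
  exact h

/-- The open cone of the vectors that make obtuse angles with both `a` and `b`. -/
def obtuseCone (a b : Plane) : Set Plane := {u | inner ℝ u a < 0 ∧ inner ℝ u b < 0}

lemma isOpen_obtuseCone (a b : Plane) : IsOpen (obtuseCone a b) := by
  have h (c : Plane) : IsOpen {u : Plane | inner ℝ u c < 0} :=
    isOpen_lt (by fun_prop) continuous_const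
  exact (h a).inter (h b)

lemma volume_obtuseCone {a b : Plane} :
    volume.real ({x | 0 < cross a x ∧ 0 < cross b x} ∩ ball 0 1)
      = volume.real (obtuseCone a b ∩ ball 0 1) := by
  have : {x | 0 < cross a x ∧ 0 < cross b x} ∩ ball 0 1
      = quarterTurn ⁻¹' (obtuseCone a b ∩ ball 0 1) := by
    ext x
    simp [obtuseCone, inner_quarterTurn]
  rw [this, measureReal_def, measureReal_def, quarterTurn.measurePreserving.measure_preimage_emb
    quarterTurn.toHomeomorph.measurableEmbedding]

/-- Interior and exterior angle make half a turn: removing the sector from the half-plane left of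
`a` leaves, up to a null set, a cone that a quarter turn carries onto `obtuseCone a b`. -/
lemma volume_sector_add {a b : Plane} (h : 0 < cross a b) :
    volume.real (sector a b ∩ ball 0 1) + volume.real (obtuseCone a b ∩ ball 0 1)
      = 1 / 2 * volume.real (ball (0 : Plane) 1) := by
  have ha : a ≠ 0 := by rintro rfl; simp [cross] at h
  rw [← volume_obtuseCone, ← volume_real_halfPlane ha]
  set M : Set Plane := {x | 0 < cross a x ∧ 0 < cross b x} ∩ ball 0 1
  have hM : MeasurableSet M :=
    ((measurableSet_lt measurable_const (continuous_cross_right a).measurable).inter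
      (measurableSet_lt measurable_const (continuous_cross_right b).measurable)).inter
      measurableSet_ball
  rw [← measureReal_union _ hM
    (measure_ne_top_of_subset inter_subset_right measure_ball_lt_top.ne)
    (measure_ne_top_of_subset inter_subset_right measure_ball_lt_top.ne)]
  · refine measureReal_congr ?_
    have h0 : ∀ᵐ x : Plane, cross a x ≠ 0 := by
      simpa [ae_iff] using volume_cross_eq_zero ha
    filter_upwards [h0] with x hx
    apply propext
    change ((0 ≤ cross a x ∧ 0 ≤ cross x b) ∧ x ∈ ball 0 1) ∨
      ((0 < cross a x ∧ 0 < cross b x) ∧ x ∈ ball 0 1) ↔ 0 ≤ cross a x ∧ x ∈ ball 0 1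
    rw [cross_swap b x]
    constructor
    · rintro (h | h)
      · exact ⟨h.1.1, h.2⟩
      · exact ⟨h.1.1.le, h.2⟩
    · rintro ⟨h1, h2⟩
      rcases le_or_gt (cross b x) 0 with h3 | h3
      · exact Or.inl ⟨⟨h1, by linarith⟩, h2⟩
      · exact Or.inr ⟨⟨lt_of_le_of_ne h1 hx.symm, h3⟩, h2⟩
  · rw [disjoint_left]
    rintro x ⟨⟨_, h1⟩, _⟩ ⟨⟨_, h2⟩, _⟩
    rw [cross_swap b x] at h1
    linarith

lemma volume_obtuseCone_pos {a b : Plane} (h : 0 < cross a b) :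
    0 < volume.real (obtuseCone a b ∩ ball 0 1) := by
  rw [← volume_obtuseCone]
  have ho : IsOpen ({x | 0 < cross a x ∧ 0 < cross b x} ∩ ball (0 : Plane) 1) :=
    ((isOpen_lt continuous_const (continuous_cross_right a)).inter
      (isOpen_lt continuous_const (continuous_cross_right b))).inter isOpen_ball
  refine ENNReal.toReal_pos (ho.measure_pos volume ?_).ne'
    (measure_ne_top_of_subset inter_subset_right measure_ball_lt_top.ne)
  -- The vector `b - a` lies strictly to the left of both `a` and `b`; small multiples of it are in
  -- the disk.
  have hs : Tendsto (fun t : ℝ => t • (b - a)) (𝓝[>] 0) (𝓝 0) := by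
    have : Continuous fun t : ℝ => t • (b - a) := by fun_prop
    simpa using (this.tendsto 0).mono_left nhdsWithin_le_nhds
  obtain ⟨t, ht, ht0⟩ := ((hs.eventually (ball_mem_nhds 0 one_pos)).and self_mem_nhdsWithin).exists
  have ht0 : 0 < t := ht0
  refine ⟨t • (b - a), ⟨?_, ?_⟩, ht⟩
  · rw [cross_smul_right, cross_sub_right, cross_same]
    have := mul_pos ht0 h
    linarith
  · rw [cross_smul_right, cross_sub_right, cross_same, cross_swap]
    have := mul_pos ht0 h
    linarith

/-- A convex set that contains `p`, `p + a` and `p + b` contains the cone spanned by `a` and `b`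
close to its apex `p`. -/
lemma eventually_mem_of_mem_sector {S : Set Plane} (hS : Convex ℝ S) {p a b : Plane} (hp : p ∈ S)
    (ha : p + a ∈ S) (hb : p + b ∈ S) (h : 0 < cross a b) :
    ∀ᶠ x in 𝓝 0, x ∈ sector a b → p + x ∈ S := by
  have hc : Tendsto (fun x => cross x b / cross a b + cross a x / cross a b) (𝓝 0) (𝓝 0) := by
    have : Continuous fun x => cross x b / cross a b + cross a x / cross a b :=
      ((continuous_cross_left b).div_const _).add ((continuous_cross_right a).div_const _)
    have := this.tendsto 0
    simpa [cross] using this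
  filter_upwards [hc.eventually_le_const one_pos] with x hx hxs
  set s := cross x b / cross a b
  set t := cross a x / cross a b
  have hs : 0 ≤ s := div_nonneg hxs.2 h.le
  have ht : 0 ≤ t := div_nonneg hxs.1 h.le
  have hx' : p + x = (1 - (s + t)) • p + s • (p + a) + t • (p + b) := by
    conv_lhs => rw [eq_of_cross_ne_zero h.ne' x]
    module
  rw [hx']
  have := hS.sum_mem (t := Finset.univ) (w := ![1 - (s + t), s, t]) (z := ![p, p + a, p + b])
    (by intro i _; fin_cases i <;> simp <;> linarith)
    (by simp [Fin.sum_univ_three]; ring)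
    (by intro i _; fin_cases i <;> simp [hp, ha, hb])
  simpa [Fin.sum_univ_three] using this

/-- The density of the cone spanned by two positively oriented vectors at its apex. -/
noncomputable def sectorDensity (a b : Plane) : ℝ :=
  volume.real (sector a b ∩ ball 0 1) / volume.real (ball (0 : Plane) 1)

lemma hasDensity_sector (a b : Plane) : HasDensity (sector a b) 0 (sectorDensity a b) :=
  hasDensity_of_cone fun t ht x => by
    simp [sector, cross_smul_right, cross_smul_left, ht]

lemma interior_nonempty_of_cross_pos {S : Set Plane} (hS : Convex ℝ S) {p a b : Plane} (hp : p ∈ S)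
    (ha : p + a ∈ S) (hb : p + b ∈ S) (h : 0 < cross a b) : (interior S).Nonempty := by
  obtain ⟨U, hU, hUo, h0⟩ := _root_.eventually_nhds_iff.1 (eventually_mem_of_mem_sector hS hp ha hb h)
  have hs : Tendsto (fun t : ℝ => t • (a + b)) (𝓝[>] 0) (𝓝 0) := by
    have : Continuous fun t : ℝ => t • (a + b) := by fun_prop
    simpa using (this.tendsto 0).mono_left nhdsWithin_le_nhds
  obtain ⟨t, ht, ht0⟩ := ((hs.eventually (hUo.mem_nhds h0)).and self_mem_nhdsWithin).exists
  have ht0 : 0 < t := ht0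
  have hV : IsOpen (U ∩ ({x | 0 < cross a x} ∩ {x | 0 < cross x b})) :=
    hUo.inter ((isOpen_lt continuous_const (continuous_cross_right a)).inter
      (isOpen_lt continuous_const (continuous_cross_left b)))
  refine ⟨p + t • (a + b), mem_interior.2 ⟨_, ?_, (isOpenMap_add_left p) _ hV,
    mem_image_of_mem _ ⟨ht, ?_, ?_⟩⟩⟩
  · rintro _ ⟨x, ⟨hxU, hx1, hx2⟩, rfl⟩
    exact hU x hxU ⟨le_of_lt hx1, le_of_lt hx2⟩
  · change 0 < cross a (t • (a + b))
    rw [cross_smul_right, cross_add_right, cross_same, zero_add]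
    positivity
  · change 0 < cross (t • (a + b)) b
    rw [cross_smul_left, cross_add_left, cross_same, add_zero]
    positivity

/-- Both coordinates of `x` in the basis `a`, `b` are nonnegative and not both vanish. Thus
directions in the obtuse cone of a corner are maximized over the polygon at that corner alone. -/
lemma inner_neg_of_mem_obtuseCone {a b u x : Plane} (h : 0 < cross a b) (hu : u ∈ obtuseCone a b)
    (hx : x ∈ sector a b) (hx0 : x ≠ 0) : inner ℝ u x < 0 := by
  have he := eq_of_cross_ne_zero h.ne' x
  have hs : 0 ≤ cross x b / cross a b := div_nonneg hx.2 h.le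
  have ht : 0 ≤ cross a x / cross a b := div_nonneg hx.1 h.le
  have hi : inner ℝ u x
      = cross x b / cross a b * inner ℝ u a + cross a x / cross a b * inner ℝ u b := by
    conv_lhs => rw [he]
    rw [inner_add_right, real_inner_smul_right, real_inner_smul_right]
  rw [hi]
  rcases hs.eq_or_lt with hs | hs
  · rcases ht.eq_or_lt with ht | ht
    · rw [← hs, ← ht] at he
      exact absurd (by simpa using he) hx0
    · rw [← hs]
      have := mul_neg_of_pos_of_neg ht hu.2
      linarith
  · have h1 := mul_neg_of_pos_of_neg hs hu.1
    have h2 := mul_nonpos_of_nonneg_of_nonpos ht hu.2.le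
    linarith

/-! ### Corners of a convex polygon and their angle sum. -/

/-- At its `i`-th vertex the convex hull of the points `v j` has a corner, with sides in the
directions of the positively oriented vectors `a` and `b`. -/
structure IsCornerAt {n : ℕ} (v : Fin n → Plane) (i : Fin n) (a b : Plane) : Prop where
  cross_pos : 0 < cross a b
  left_mem : v i + a ∈ range v
  right_mem : v i + b ∈ range v
  sub_mem_sector : ∀ j, v j - v i ∈ sector a b
  ne : ∀ j, j ≠ i → v j ≠ v i

lemma cross_sub_eq_of_mem_line {p q x y : Plane} (hx : x ∈ line[ℝ, p, q]) :
    cross (q - p) (y - x) = cross (q - p) (y - p) := by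
  obtain ⟨t, rfl⟩ := mem_affineSpan_pair_iff_exists_lineMap_eq.1 hx
  rw [AffineMap.lineMap_apply, vsub_eq_sub, vadd_eq_add,
    show y - (t • (q - p) + p) = (y - p) - t • (q - p) by abel, cross_sub_right, cross_smul_right,
    cross_same]
  ring

lemma cross_ne_zero_of_notMem_line {p q x : Plane} (hpq : p ≠ q) (hx : x ∉ line[ℝ, p, q]) :
    cross (q - p) (x - p) ≠ 0 := by
  intro h
  obtain ⟨t, ht⟩ := exists_smul_eq_of_cross_eq_zero (sub_ne_zero.2 hpq.symm) h
  apply hx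
  rw [mem_affineSpan_pair_iff_exists_lineMap_eq]
  refine ⟨t, ?_⟩
  rw [AffineMap.lineMap_apply, vsub_eq_sub, vadd_eq_add, ← ht, sub_add_cancel]

lemma AffineSubspace.SSameSide.cross_mul_pos {p q x y : Plane} (hpq : p ≠ q)
    (h : (line[ℝ, p, q]).SSameSide x y) :
    0 < cross (q - p) (x - p) * cross (q - p) (y - p) := by
  obtain ⟨⟨p₁, hp₁, p₂, hp₂, hr⟩, hx, hy⟩ := h
  have hx' := cross_ne_zero_of_notMem_line hpq hx
  have hy' := cross_ne_zero_of_notMem_line hpq hy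
  rcases hr with h | h | ⟨r₁, r₂, h₁, h₂, h⟩
  · rw [vsub_eq_sub, sub_eq_zero] at h
    exact absurd (h ▸ hp₁) hx
  · rw [vsub_eq_sub, sub_eq_zero] at h
    exact absurd (h ▸ hp₂) hy
  · have h3 := congrArg (cross (q - p)) h
    rw [cross_smul_right, cross_smul_right, vsub_eq_sub, vsub_eq_sub,
      cross_sub_eq_of_mem_line hp₁, cross_sub_eq_of_mem_line hp₂] at h3
    set X := cross (q - p) (x - p)
    set Y := cross (q - p) (y - p)
    have hX : X = r₂ / r₁ * Y := by field_simp; linarith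
    rw [hX, mul_assoc]
    exact mul_pos (div_pos h₂ h₁) (mul_self_pos.2 hy')

lemma IsConvexPolygon.exists_isCornerAt {n : ℕ} {poly : Polygon Plane n}
    (h : IsConvexPolygon poly) (i : Fin n) : ∃ a b, IsCornerAt poly.vertices i a b := by
  obtain ⟨m, rfl⟩ : ∃ m, n = m + 3 := ⟨n - 3, by have := h.three_le; omega⟩
  -- `k` and `j` become the predecessor and the successor of the vertex; they differ because there
  -- are at least three vertices.
  obtain ⟨k, rfl⟩ := (finRotate (m + 3)).surjective i
  set i := finRotate (m + 3) k with hi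
  set j := finRotate (m + 3) i with hj
  have hik : i = k + 1 := by simp [hi]
  have hji : j = k + 1 + 1 := by simp [hj, hi]
  have h10 : (1 : Fin (m + 3)) ≠ 0 := by simp
  have h20 : (1 + 1 : Fin (m + 3)) ≠ 0 := by
    rw [Ne, Fin.ext_iff, Fin.val_add]
    simp [Nat.mod_eq_of_lt (show 1 + 1 < m + 3 by omega)]
  have hki : k ≠ i := by rw [hik]; simp
  have hkj : k ≠ j := by
    rw [hji, add_assoc]
    intro h
    exact h20 (left_eq_add.1 h)
  have hij : i ≠ j := by rw [hji, hik]; simp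
  have hvi : poly i ≠ poly j := h.hasNondegenerateEdges i
  have hvk : poly k ≠ poly i := h.hasNondegenerateEdges k
  set a := poly j - poly i with ha
  set b := poly k - poly i with hb
  have hβ : ∀ l, l ≠ i → l ≠ j → 0 < cross a (poly l - poly i) * cross a b := fun l h1 h2 =>
    (h.sSameSide i l k h1 h2 hki hkj).cross_mul_pos hvi
  have hα : ∀ l, l ≠ i → l ≠ k → 0 < cross (poly l - poly i) b * cross a b := by
    intro l h1 h2
    have := (h.sSameSide k l j h2 h1 hkj.symm hij.symm).cross_mul_pos hvk
    have e (x : Plane) : cross (poly i - poly k) (x - poly k) = cross (x - poly i) b := by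
      simp only [hb, cross, PiLp.sub_apply]; ring
    change 0 < cross (poly i - poly k) (poly l - poly k) *
      cross (poly i - poly k) (poly j - poly k) at this
    rwa [e, e] at this
  have hab : cross a b ≠ 0 := fun h0 => by simpa [h0] using hα j hij.symm hkj.symm
  have hne : ∀ l, l ≠ i → poly l ≠ poly i := by
    intro l hl he
    rcases eq_or_ne l j with rfl | hlj
    · exact hvi he.symm
    · simpa [he, cross] using hβ l hl hlj
  have hα' : ∀ l, 0 ≤ cross (poly l - poly i) b * cross a b := by
    intro l
    rcases eq_or_ne l i with rfl | h1
    · simp [cross]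
    rcases eq_or_ne l k with rfl | h2
    · rw [← hb, cross_same, zero_mul]
    exact (hα l h1 h2).le
  have hβ' : ∀ l, 0 ≤ cross a (poly l - poly i) * cross a b := by
    intro l
    rcases eq_or_ne l i with rfl | h1
    · simp [cross]
    rcases eq_or_ne l j with rfl | h2
    · rw [← ha, cross_same, zero_mul]
    exact (hβ l h1 h2).le
  have hja : poly i + a = poly j := by rw [ha]; abel
  have hkb : poly i + b = poly k := by rw [hb]; abel
  -- The vertices may run clockwise; then the two sides of the corner trade places.
  rcases lt_or_gt_of_ne hab with hneg | hpos
  · refine ⟨b, a, by rw [cross_swap]; linarith, ⟨k, hkb.symm⟩, ⟨j, hja.symm⟩, fun l => ⟨?_, ?_⟩, hne⟩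
    · rw [cross_swap]
      exact neg_nonneg.2 (nonpos_of_mul_nonneg_left (hα' l) hneg)
    · rw [cross_swap]
      exact neg_nonneg.2 (nonpos_of_mul_nonneg_left (hβ' l) hneg)
  · exact ⟨a, b, hpos, ⟨j, hja.symm⟩, ⟨k, hkb.symm⟩,
      fun l => ⟨nonneg_of_mul_nonneg_left (hβ' l) hpos, nonneg_of_mul_nonneg_left (hα' l) hpos⟩, hne⟩

section Corner

variable {n : ℕ} {v : Fin n → Plane} {i : Fin n} {a b : Plane}

lemma convex_sector (a b : Plane) : Convex ℝ (sector a b) := by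
  intro x hx y hy s t hs ht _
  constructor
  · rw [cross_add_right, cross_smul_right, cross_smul_right]
    exact add_nonneg (mul_nonneg hs hx.1) (mul_nonneg ht hy.1)
  · rw [cross_add_left, cross_smul_left, cross_smul_left]
    exact add_nonneg (mul_nonneg hs hx.2) (mul_nonneg ht hy.2)

/-- The hull lies in the translated sector by convexity of the sector, and fills it near the apex
because it contains the endpoints of both sides. -/
lemma IsCornerAt.hasDensity (h : IsCornerAt v i a b) :
    HasDensity (convexHull ℝ (range v)) (v i) (sectorDensity a b) := by
  have hsub : convexHull ℝ (range v) ⊆ (fun x => -v i + x) ⁻¹' sector a b := by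
    refine convexHull_min ?_ ((convex_sector a b).translate_preimage_right _)
    rintro _ ⟨j, rfl⟩
    rw [mem_preimage, neg_add_eq_sub]
    exact h.sub_mem_sector j
  refine (hasDensity_sector a b).vadd ?_
  have hv := subset_convexHull ℝ (range v)
  filter_upwards [eventually_mem_of_mem_sector (convex_convexHull ℝ (range v))
    (hv (mem_range_self i)) (hv h.left_mem) (hv h.right_mem) h.cross_pos] with x hx
  exact ⟨fun hx' => by simpa using hsub hx', hx⟩

lemma sectorDensity_lt_half (h : 0 < cross a b) : sectorDensity a b < 1 / 2 := by
  have hB := volume_real_ball_pos (0 : Plane) one_pos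
  rw [sectorDensity, div_lt_iff₀ hB]
  linarith [volume_sector_add h, volume_obtuseCone_pos h]

lemma sectorDensity_nonneg (a b : Plane) : 0 ≤ sectorDensity a b := by
  unfold sectorDensity; positivity

/-- The external angles of a convex polygon add up to at most a full turn. -/
lemma sum_sectorDensity {a b : Fin n → Plane} (h : ∀ i, IsCornerAt v i (a i) (b i)) :
    (n : ℝ) / 2 - 1 ≤ ∑ i, sectorDensity (a i) (b i) := by
  have hB := volume_real_ball_pos (0 : Plane) one_pos
  set B : Set Plane := ball 0 1 with hBdef
  -- A common direction `u` would have its strict maximum over the vertices at both `v i` and `v j`.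
  have hdisj : Pairwise fun i j => Disjoint (obtuseCone (a i) (b i) ∩ B)
      (obtuseCone (a j) (b j) ∩ B) := by
    intro i j hij
    rw [disjoint_left]
    rintro u ⟨hi, _⟩ ⟨hj, _⟩
    have h1 := inner_neg_of_mem_obtuseCone (h i).cross_pos hi ((h i).sub_mem_sector j)
      (sub_ne_zero.2 ((h i).ne j hij.symm))
    have h2 := inner_neg_of_mem_obtuseCone (h j).cross_pos hj ((h j).sub_mem_sector i)
      (sub_ne_zero.2 ((h j).ne i hij))
    rw [inner_sub_right] at h1 h2
    linarith
  have hsum : ∑ i, volume.real (obtuseCone (a i) (b i) ∩ B) ≤ volume.real B := by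
    have hfin : volume B ≠ ⊤ := measure_ball_lt_top.ne
    rw [← measureReal_biUnion_finset (fun i _ j _ hij => hdisj hij)
      (fun i _ => ((isOpen_obtuseCone _ _).inter isOpen_ball).measurableSet)
      (fun i _ => measure_ne_top_of_subset inter_subset_right hfin)]
    exact measureReal_mono (iUnion₂_subset fun i _ => inter_subset_right) hfin
  have hi : ∀ i, sectorDensity (a i) (b i)
      = 1 / 2 - volume.real (obtuseCone (a i) (b i) ∩ B) / volume.real B := by
    intro i
    rw [sectorDensity]
    have := volume_sector_add (h i).cross_pos
    rw [← hBdef] at this ⊢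
    field_simp
    linarith
  simp only [hi, Finset.sum_sub_distrib, ← Finset.sum_div, Finset.sum_const, Finset.card_univ,
    Fintype.card_fin, nsmul_eq_mul]
  have := (div_le_one hB).2 hsum
  linarith

end Corner

/-! ### Density of a convex set at its non-extreme points. -/

/-- The sectors from `e` to `w` and from `w` to `-e` together fill the half-plane, and `S` contains
each of them near `p`. -/
lemma hasDensity_half_of_mem {S : Set Plane} (hS : Convex ℝ S) {p e w : Plane} {t : ℝ} (hp : p ∈ S)
    (ht : 0 < t) (he : p + e ∈ S) (he' : p + (-t) • e ∈ S) (hw : p + w ∈ S) (hew : 0 < cross e w)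
    (hle : ∀ z ∈ S, 0 ≤ cross e (z - p)) : HasDensity S p (1 / 2) := by
  have he0 : e ≠ 0 := by rintro rfl; simp [cross] at hew
  refine (hasDensity_halfPlane he0).vadd ?_
  have hwe : 0 < cross w ((-t) • e) := by
    rw [cross_smul_right, cross_swap]
    have := mul_pos ht hew
    linarith
  filter_upwards [eventually_mem_of_mem_sector hS hp he hw hew,
    eventually_mem_of_mem_sector hS hp hw he' hwe] with x h1 h2
  refine ⟨fun hx => by simpa using hle _ hx, fun hx => ?_⟩
  have hx : 0 ≤ cross e x := hx
  rcases le_total 0 (cross x w) with h | h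
  · exact h1 ⟨hx, h⟩
  · refine h2 ⟨by rw [cross_swap]; linarith, ?_⟩
    rw [cross_smul_right, cross_swap]
    have := mul_nonneg ht.le hx
    linarith

/-- At a point that is not a vertex, a convex polygon has density `1 / 2` or `1`. -/
lemma hasDensity_of_notMem_extremePoints {S : Set Plane} (hS : Convex ℝ S)
    (hne : (interior S).Nonempty) {p : Plane} (hp : p ∈ S) (hpe : p ∉ S.extremePoints ℝ) :
    HasDensity S p (1 / 2) ∨ HasDensity S p 1 := by
  by_cases hi : p ∈ interior S
  · exact Or.inr (hasDensity_of_mem_nhds (mem_interior_iff_mem_nhds.1 hi))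
  left
  obtain ⟨f, hf⟩ := geometric_hahn_banach_open_point hS.interior isOpen_interior hi
  have hfS : ∀ z ∈ S, f z ≤ f p := by
    intro z hz
    have hz' : z ∈ closure (interior S) := by
      rw [hS.closure_interior_eq_closure_of_nonempty_interior hne]
      exact subset_closure hz
    exact closure_minimal (fun y hy => (hf y hy).le)
      (isClosed_le f.continuous continuous_const) hz'
  obtain ⟨c, hc⟩ := hne
  have hcS := interior_subset hc
  have hfc : f (c - p) < 0 := by rw [map_sub]; linarith [hf c hc]
  obtain ⟨e, t, ht, he, he', hen⟩ : ∃ (e : Plane) (t : ℝ), 0 < t ∧ p + e ∈ S ∧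
      p + (-t) • e ∈ S ∧ e ≠ 0 := by
    simp only [mem_extremePoints, not_and, not_forall] at hpe
    obtain ⟨x, hx, y, hy, hxy, hne⟩ := hpe hp
    obtain ⟨s, t, hs, ht, hst, hpxy⟩ := hxy
    have hy' : p + (-(s / t)) • (x - p) = y := by
      have : y = t⁻¹ • (p - s • x) := by
        rw [← hpxy, add_sub_cancel_left, smul_smul, inv_mul_cancel₀ ht.ne', one_smul]
      rw [this]
      have h1 : t⁻¹ = 1 + s / t := by field_simp; linarith
      have h2 : s / t = t⁻¹ * s := by field_simp
      rw [smul_sub t⁻¹, smul_smul, ← h2, h1]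
      module
    refine ⟨x - p, s / t, div_pos hs ht, by simpa using hx, hy' ▸ hy, ?_⟩
    intro h0
    rw [h0, smul_zero, add_zero] at hy'
    exact hne (sub_eq_zero.1 h0) hy'.symm
  -- The supporting functional is maximal at `p`, which lies strictly between two points of `S` in
  -- the directions `e` and `-e`.
  have hfe : f e = 0 := by
    have h1 := hfS _ he
    have h2 := hfS _ he'
    rw [map_add] at h1 h2
    rw [map_smul, smul_eq_mul] at h2
    have h3 : 0 ≤ t * f e := by linarith
    exact le_antisymm (by linarith) (nonneg_of_mul_nonneg_right h3 ht)
  have key : ∀ e : Plane, f e = 0 → 0 < cross e (c - p) → ∀ z ∈ S, 0 ≤ cross e (z - p) := by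
    intro e hfe hpos z hz
    have h1 := congrArg f (eq_of_cross_ne_zero hpos.ne' (z - p))
    rw [map_add, map_smul, map_smul, hfe, smul_zero, zero_add, smul_eq_mul, map_sub] at h1
    have h2 : 0 ≤ cross e (z - p) / cross e (c - p) := by
      by_contra! h
      have := mul_pos_of_neg_of_neg h hfc
      linarith [hfS z hz]
    simpa [hpos.ne'] using mul_nonneg h2 hpos.le
  have hcp : p + (c - p) ∈ S := by simpa using hcS
  have hne0 : cross e (c - p) ≠ 0 := by
    intro h0
    obtain ⟨s, hs⟩ := exists_smul_eq_of_cross_eq_zero hen h0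
    rw [hs, map_smul, hfe, smul_zero] at hfc
    exact lt_irrefl _ hfc
  -- The direction of `e` was arbitrary; if the interior point `c` is to its right, the opposite
  -- vector `(-t) • e` is used, with ratio `t⁻¹`.
  rcases lt_or_gt_of_ne hne0 with hneg | hpos
  · have hpos' : 0 < cross ((-t) • e) (c - p) := by
      rw [cross_smul_left]
      exact mul_pos_of_neg_of_neg (by linarith) hneg
    have hfe' : f ((-t) • e) = 0 := by rw [map_smul, hfe, smul_zero]
    refine hasDensity_half_of_mem hS hp (inv_pos.2 ht) he' ?_ hcp hpos' (key _ hfe' hpos')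
    rwa [smul_smul, neg_mul_neg, inv_mul_cancel₀ ht.ne', one_smul]
  · exact hasDensity_half_of_mem hS hp ht he he' hcp hpos (key e hfe hpos)

/-! ### Local finiteness and area counts in tessellations. -/

section Tessellation

variable {P : Set Plane} {𝒯 : Set (Set Plane)} {T T' : Set Plane}

lemma IsCopyOf.isCompact (h : IsCopyOf T P) (hk : IsCompact P) : IsCompact T := by
  obtain ⟨g, rfl⟩ := h
  exact hk.image g.continuous

lemma IsCopyOf.convex (h : IsCopyOf T P) (hc : Convex ℝ P) : Convex ℝ T := by
  obtain ⟨g, rfl⟩ := h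
  exact hc.affine_image g.toAffineEquiv.toAffineMap

lemma IsCopyOf.volume_eq (h : IsCopyOf T P) : volume T = volume P := by
  obtain ⟨g, rfl⟩ := h
  exact volume_image_affineIsometryEquiv g P

lemma IsCopyOf.dist_le (h : IsCopyOf T P) (hk : IsCompact P) {x y : Plane} (hx : x ∈ T)
    (hy : y ∈ T) : dist x y ≤ diam P := by
  obtain ⟨g, rfl⟩ := h
  rw [← g.isometry.diam_image P]
  exact dist_le_diam_of_mem (hk.image g.continuous).isBounded hx hy

/-- A copy of a compact set that meets a disk lies in a larger concentric disk. -/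
lemma IsCopyOf.subset_ball (h : IsCopyOf T P) (hk : IsCompact P) {c : Plane} {R : ℝ}
    (hT : (T ∩ ball c R).Nonempty) : T ⊆ ball c (R + (diam P + 1)) := by
  obtain ⟨x, hx, hxR⟩ := hT
  intro y hy
  have h1 := h.dist_le hk hy hx
  have h2 := dist_triangle y x c
  rw [mem_ball] at hxR ⊢
  linarith

/-- Convex sets have null frontier, so disjoint interiors leave only a null overlap. -/
lemma IsTessellation.aedisjoint (h : IsTessellation P 𝒯) (hc : Convex ℝ P) (hT : T ∈ 𝒯)
    (hT' : T' ∈ 𝒯) (hne : T ≠ T') : AEDisjoint volume T T' := by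
  have h1 := ((h.isCopyOf T hT).convex hc).addHaar_frontier volume
  have h2 := ((h.isCopyOf T' hT').convex hc).addHaar_frontier volume
  refine measure_mono_null ?_ (measure_union_null h1 h2)
  rintro x ⟨hx, hx'⟩
  by_contra hn
  rw [mem_union, not_or] at hn
  have hi : x ∈ interior T := by
    by_contra hi; exact hn.1 ⟨subset_closure hx, hi⟩
  have hi' : x ∈ interior T' := by
    by_contra hi; exact hn.2 ⟨subset_closure hx', hi⟩
  exact disjoint_left.1 (h.disjoint_interior T hT T' hT' hne) hi hi'

lemma volume_pos_of_interior_nonempty (hi : (interior P).Nonempty) : 0 < volume P :=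
  (isOpen_interior.measure_pos volume hi).trans_le (measure_mono interior_subset)

/-- A tessellation is locally finite. -/
lemma IsTessellation.finite_meeting (h : IsTessellation P 𝒯) (hc : Convex ℝ P) (hk : IsCompact P)
    (hi : (interior P).Nonempty) (c : Plane) (R : ℝ) :
    {T ∈ 𝒯 | (T ∩ ball c R).Nonempty}.Finite := by
  set 𝒮 := {T ∈ 𝒯 | (T ∩ ball c R).Nonempty}
  -- These tiles are almost disjoint, share one positive area and lie in a common larger disk.
  have hfin := Measure.finite_const_le_meas_of_disjoint_iUnion₀ volume
    (volume_pos_of_interior_nonempty hi) (As := fun T : 𝒮 => T.1)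
    (fun T => ((h.isCopyOf _ T.2.1).isCompact hk).measurableSet.nullMeasurableSet)
    (fun T T' hne => h.aedisjoint hc T.2.1 T'.2.1 fun h => hne (Subtype.ext h))
    (measure_ne_top_of_subset (t := ⋃ T : 𝒮, T.1) (s := ball c (R + (diam P + 1)))
      (iUnion_subset fun T => (h.isCopyOf _ T.2.1).subset_ball hk T.2.2) measure_ball_lt_top.ne)
  have hall : {T : 𝒮 | volume P ≤ volume T.1} = univ :=
    eq_univ_of_forall fun T => (h.isCopyOf _ T.2.1).volume_eq.ge
  rw [hall, finite_univ_iff] at hfin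
  exact hfin

lemma IsTessellation.volume_biUnion (h : IsTessellation P 𝒯) (hc : Convex ℝ P) (hk : IsCompact P)
    {F : Finset (Set Plane)} (hF : ∀ T ∈ F, T ∈ 𝒯) {B : Set Plane} (hB : MeasurableSet B) :
    volume.real (⋃ T ∈ F, T ∩ B) = ∑ T ∈ F, volume.real (T ∩ B) := by
  refine measureReal_biUnion_finset₀ ?_ ?_ ?_
  · intro T hT T' hT' hne
    exact (h.aedisjoint hc (hF T hT) (hF T' hT') hne).mono inter_subset_left inter_subset_left
  · intro T hT
    exact (((h.isCopyOf T (hF T hT)).isCompact hk).measurableSet.inter hB).nullMeasurableSet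
  · intro T hT
    exact measure_ne_top_of_subset inter_subset_left
      ((h.isCopyOf T (hF T hT)).isCompact hk).measure_lt_top.ne

lemma IsTessellation.exists_mem (h : IsTessellation P 𝒯) (x : Plane) : ∃ T ∈ 𝒯, x ∈ T := by
  have : x ∈ ⋃₀ 𝒯 := h.sUnion_eq ▸ mem_univ x
  exact this

/-- The densities at a point of the tiles that contain it add up to `1`. -/
lemma IsTessellation.sum_density (h : IsTessellation P 𝒯) (hc : Convex ℝ P) (hk : IsCompact P)
    (hi : (interior P).Nonempty) {p : Plane} {F : Finset (Set Plane)}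
    (hF : ∀ T, T ∈ F ↔ T ∈ 𝒯 ∧ p ∈ T) {δ : Set Plane → ℝ}
    (hδ : ∀ T ∈ F, HasDensity T p (δ T)) : ∑ T ∈ F, δ T = 1 := by
  -- Finitely many closed tiles that miss `p` stay away from it, so near `p` the tiles in `F` alone
  -- cover.
  have h1 : ∀ᶠ x in 𝓝 p, ∀ T ∈ {T ∈ 𝒯 | (T ∩ ball p 1).Nonempty}, p ∉ T → x ∉ T := by
    rw [(h.finite_meeting hc hk hi p 1).eventually_all]
    intro T hT
    by_cases hp : p ∈ T
    · exact Eventually.of_forall fun x hn => absurd hp hn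
    · filter_upwards [((h.isCopyOf T hT.1).isCompact hk).isClosed.isOpen_compl.mem_nhds hp]
        with x hx _ using hx
  have h2 : ∀ᶠ x in 𝓝 p, ∃ T ∈ F, x ∈ T := by
    filter_upwards [h1, ball_mem_nhds p one_pos] with x hx hxb
    obtain ⟨T, hT, hxT⟩ := h.exists_mem x
    refine ⟨T, (hF T).2 ⟨hT, ?_⟩, hxT⟩
    by_contra hp
    exact hx T ⟨hT, x, hxT, hxb⟩ hp hxT
  have h3 : ∀ᶠ r in 𝓝[>] (0 : ℝ), ∀ T ∈ F,
      volume.real (T ∩ ball p r) = δ T * volume.real (ball p r) :=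
    (F.finite_toSet.eventually_all).2 hδ
  obtain ⟨r, hr, hr', hr0⟩ :=
    ((eventually_ball_of_nhds h2).and (h3.and self_mem_nhdsWithin)).exists
  have hpos := volume_real_ball_pos p hr0
  have hU : ⋃ T ∈ F, T ∩ ball p r = ball p r := by
    refine subset_antisymm (iUnion₂_subset fun T _ => inter_subset_right) fun x hx => ?_
    obtain ⟨T, hT, hxT⟩ := hr x hx
    exact mem_iUnion₂.2 ⟨T, hT, hxT, hx⟩
  have := h.volume_biUnion hc hk (fun T hT => ((hF T).1 hT).1) (measurableSet_ball (x := p) (ε := r))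
  rw [hU, Finset.sum_congr rfl hr', ← Finset.sum_mul] at this
  exact mul_right_cancel₀ hpos.ne' (by rw [one_mul]; exact this.symm)

lemma IsTessellation.sum_volume (h : IsTessellation P 𝒯) {F : Finset (Set Plane)}
    (hF : ∀ T ∈ F, T ∈ 𝒯) : ∑ T ∈ F, volume.real T = F.card * volume.real P := by
  rw [← nsmul_eq_mul]
  refine Finset.sum_eq_card_nsmul fun T hT => ?_
  rw [measureReal_def, measureReal_def, (h.isCopyOf T (hF T hT)).volume_eq]

lemma IsTessellation.card_mul_le (h : IsTessellation P 𝒯) (hc : Convex ℝ P) (hk : IsCompact P)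
    {F : Finset (Set Plane)} (hF : ∀ T ∈ F, T ∈ 𝒯) {R : ℝ}
    (hR : ∀ T ∈ F, T ⊆ ball 0 R) : F.card * volume.real P ≤ volume.real (ball (0 : Plane) R) := by
  have h1 := h.volume_biUnion hc hk hF MeasurableSet.univ
  simp only [inter_univ] at h1
  rw [← h.sum_volume hF, ← h1]
  exact measureReal_mono (iUnion₂_subset hR) measure_ball_lt_top.ne

lemma IsTessellation.le_card_mul (h : IsTessellation P 𝒯) {F : Finset (Set Plane)}
    (hF : ∀ T ∈ F, T ∈ 𝒯) (hk : IsCompact P) {B : Set Plane} (hB : ∀ x ∈ B, ∃ T ∈ F, x ∈ T) :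
    volume.real B ≤ F.card * volume.real P := by
  rw [← h.sum_volume hF]
  refine (measureReal_mono (fun x hx => ?_) ?_).trans (measureReal_biUnion_finset_le F fun T => T)
  · obtain ⟨T, hT, hxT⟩ := hB x hx
    exact mem_iUnion₂.2 ⟨T, hT, hxT⟩
  · exact (F.finite_toSet.isCompact_biUnion
      fun T hT => (h.isCopyOf T (hF T hT)).isCompact hk).measure_lt_top.ne

end Tessellation

/-! ### Averaging corner angles at points and over disks. -/

/-- If angles at a point, measured in full turns, add up to `1` and each of them is less than
`1 / 2`, equal to `1 / 2` or equal to `1`, then the average of those less than `1 / 2` is at most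
`1 / 3`. -/
lemma sum_le_card_div_three {α : Type*} {C N : Finset α} {δ : α → ℝ} (hC : ∀ x ∈ C, δ x < 1 / 2)
    (hN : ∀ x ∈ N, δ x = 1 / 2 ∨ δ x = 1) (h : ∑ x ∈ C, δ x + ∑ x ∈ N, δ x = 1) :
    ∑ x ∈ C, δ x ≤ (C.card : ℝ) / 3 := by
  have hNle : (N.card : ℝ) * (1 / 2) ≤ ∑ x ∈ N, δ x := by
    rw [← nsmul_eq_mul]
    refine Finset.card_nsmul_le_sum _ _ _ fun x hx => ?_
    rcases hN x hx with h | h <;> linarith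
  rcases C.eq_empty_or_nonempty with rfl | hCne
  · simp
  have hClt : ∑ x ∈ C, δ x < C.card * (1 / 2) := by
    rw [← nsmul_eq_mul, ← Finset.sum_const]
    exact Finset.sum_lt_sum_of_nonempty hCne hC
  have hC1 : 1 ≤ C.card := hCne.card_pos
  -- With three or more corners, the total `1` is already at most a third of their number.
  rcases Nat.lt_or_ge 2 C.card with h3 | h3
  · have h3 : (3 : ℝ) ≤ C.card := by exact_mod_cast h3
    linarith [(Nat.cast_nonneg N.card : (0 : ℝ) ≤ N.card)]
  have hC2 : (C.card : ℝ) ≤ 2 := by exact_mod_cast h3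
  rcases N.eq_empty_or_nonempty with rfl | hNne
  · rw [Finset.sum_empty] at h
    linarith
  have hN1 : (1 : ℝ) ≤ N.card := by exact_mod_cast hNne.card_pos
  rcases Nat.lt_or_ge 1 C.card with h2 | h2
  · have h2 : (2 : ℝ) ≤ C.card := by exact_mod_cast h2
    linarith
  have hCc : (C.card : ℝ) = 1 := by exact_mod_cast le_antisymm h2 hC1
  rw [hCc] at hClt ⊢
  rcases Nat.lt_or_ge 1 N.card with hN2 | hN2
  · have hN2 : (2 : ℝ) ≤ N.card := by exact_mod_cast hN2
    linarith
  -- One corner and one other tile: the value `1 / 2` would force the corner to be `1 / 2` too, and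
  -- the value `1` leaves it `0`.
  · obtain ⟨x, rfl⟩ := Finset.card_eq_one.1 (le_antisymm hN2 hNne.card_pos)
    rw [Finset.sum_singleton] at h
    rcases hN x (Finset.mem_singleton_self x) with h' | h' <;> linarith

/-- The densities of a convex polygon at its corners. -/
lemma IsConvexPolygon.exists_density {n : ℕ} {poly : Polygon Plane n} (h : IsConvexPolygon poly) :
    ∃ d : Fin n → ℝ, (∀ i, HasDensity poly.region (poly i) (d i)) ∧ (∀ i, 0 ≤ d i) ∧
      (∀ i, d i < 1 / 2) ∧ (n : ℝ) / 2 - 1 ≤ ∑ i, d i := by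
  choose a b hab using h.exists_isCornerAt
  exact ⟨fun i => sectorDensity (a i) (b i), fun i => (hab i).hasDensity,
    fun i => sectorDensity_nonneg _ _, fun i => sectorDensity_lt_half (hab i).cross_pos,
    sum_sectorDensity hab⟩

lemma IsConvexPolygon.injective {n : ℕ} {poly : Polygon Plane n} (h : IsConvexPolygon poly) :
    Function.Injective poly.vertices := by
  intro i j hij
  obtain ⟨a, b, hab⟩ := h.exists_isCornerAt j
  by_contra hne
  exact hab.ne i hne hij

lemma Polygon.convex_region {n : ℕ} (poly : Polygon Plane n) : Convex ℝ poly.region :=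
  convex_convexHull ℝ _

lemma Polygon.isCompact_region {n : ℕ} (poly : Polygon Plane n) : IsCompact poly.region :=
  (finite_range _).isCompact_convexHull ℝ

lemma Polygon.vertex_mem_region {n : ℕ} (poly : Polygon Plane n) (i : Fin n) :
    poly i ∈ poly.region :=
  subset_convexHull ℝ _ (mem_range_self i)

lemma IsConvexPolygon.interior_nonempty {n : ℕ} {poly : Polygon Plane n}
    (h : IsConvexPolygon poly) : (interior poly.region).Nonempty := by
  obtain ⟨a, b, hab⟩ := h.exists_isCornerAt ⟨0, by have := h.three_le; omega⟩
  have hv := subset_convexHull ℝ (range poly.vertices)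
  exact interior_nonempty_of_cross_pos poly.convex_region (poly.vertex_mem_region _)
    (hv hab.left_mem) (hv hab.right_mem) hab.cross_pos

section Counting

variable {n : ℕ} {poly : Polygon Plane n} {𝒯 : Set (Set Plane)} {d : Fin n → ℝ}
  {g : Set Plane → Plane ≃ᵃⁱ[ℝ] Plane}

open Classical in
/-- At every point, the average of the corner angles that meet there is at most a third of a
full turn. -/
lemma IsTessellation.local_sum_nonneg (hpoly : IsConvexPolygon poly)
    (h : IsTessellation poly.region 𝒯) (hd : ∀ i, HasDensity poly.region (poly i) (d i))
    (hd2 : ∀ i, d i < 1 / 2) (hg : ∀ T ∈ 𝒯, T = g T '' poly.region) {p : Plane}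
    {F : Finset (Set Plane)} (hF : ∀ T, T ∈ F ↔ T ∈ 𝒯 ∧ p ∈ T) :
    0 ≤ ∑ T ∈ F, ∑ i, if g T (poly i) = p then 1 / 3 - d i else 0 := by
  -- A tile has at most one vertex at `p`, so its inner sum has at most one nonzero term; without a
  -- vertex there, `p` is the image of a non-extreme point.
  have hdens : ∀ T ∈ F, ∃ δ : ℝ, HasDensity T p δ ∧
      ((∃ i, g T (poly i) = p) → δ < 1 / 2 ∧
        (∑ i, if g T (poly i) = p then 1 / 3 - d i else 0) = 1 / 3 - δ) ∧
      ((¬ ∃ i, g T (poly i) = p) → (δ = 1 / 2 ∨ δ = 1) ∧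
        (∑ i, if g T (poly i) = p then 1 / 3 - d i else 0) = 0) := by
    intro T hT
    obtain ⟨hT, hp⟩ := (hF T).1 hT
    have hgT := hg T hT
    by_cases hi : ∃ i, g T (poly i) = p
    · obtain ⟨i, rfl⟩ := hi
      refine ⟨d i, ?_, fun _ => ⟨hd2 i, ?_⟩, fun hn => absurd ⟨i, rfl⟩ hn⟩
      · have := (hd i).image (g T)
        rwa [← hgT] at this
      · have : ∀ j, g T (poly j) = g T (poly i) ↔ j = i := fun j =>
          ⟨fun h => hpoly.injective ((g T).injective h), fun h => by rw [h]⟩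
        simp only [this, Finset.sum_ite_eq', Finset.mem_univ, if_true]
    · obtain ⟨q, hq, hqp⟩ : p ∈ g T '' poly.region := hgT ▸ hp
      have hqe : q ∉ poly.region.extremePoints ℝ := fun hq' => by
        obtain ⟨i, rfl⟩ := extremePoints_convexHull_subset hq'
        exact hi ⟨i, hqp⟩
      obtain ⟨δ, hδ, hδ'⟩ : ∃ δ, HasDensity poly.region q δ ∧ (δ = 1 / 2 ∨ δ = 1) := by
        rcases hasDensity_of_notMem_extremePoints poly.convex_region hpoly.interior_nonempty hq hqe
          with h | h
        · exact ⟨_, h, Or.inl rfl⟩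
        · exact ⟨_, h, Or.inr rfl⟩
      refine ⟨δ, ?_, fun h => absurd h hi, fun _ => ⟨hδ', ?_⟩⟩
      · have := hδ.image (g T)
        rwa [← hgT, hqp] at this
      · exact Finset.sum_eq_zero fun i _ => if_neg fun h => hi ⟨i, h⟩
  choose! δ hδ hC hN using hdens
  have hsum := h.sum_density poly.convex_region poly.isCompact_region hpoly.interior_nonempty hF hδ
  rw [← Finset.sum_filter_add_sum_filter_not F (fun T => ∃ i, g T (poly i) = p)] at hsum ⊢
  have hle := sum_le_card_div_three (δ := δ)
    (fun T hT => (hC T (Finset.mem_filter.1 hT).1 (Finset.mem_filter.1 hT).2).1)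
    (fun T hT => (hN T (Finset.mem_filter.1 hT).1 (Finset.mem_filter.1 hT).2).1) hsum
  rw [Finset.sum_congr rfl
      fun T hT => (hC T (Finset.mem_filter.1 hT).1 (Finset.mem_filter.1 hT).2).2,
    Finset.sum_congr (s₁ := F.filter fun T => ¬ ∃ i, g T (poly i) = p) rfl
      fun T hT => (hN T (Finset.mem_filter.1 hT).1 (Finset.mem_filter.1 hT).2).2,
    Finset.sum_sub_distrib, Finset.sum_const, Finset.sum_const_zero, nsmul_eq_mul]
  linarith

open Classical in
/-- The average of the corner angles in a disk is at most a third of a full turn. -/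
lemma IsTessellation.sum_ball_nonneg (hpoly : IsConvexPolygon poly)
    (h : IsTessellation poly.region 𝒯) (hd : ∀ i, HasDensity poly.region (poly i) (d i))
    (hd2 : ∀ i, d i < 1 / 2) (hg : ∀ T ∈ 𝒯, T = g T '' poly.region) {R : ℝ}
    {M : Finset (Set Plane)} (hM : ∀ T, T ∈ M ↔ T ∈ 𝒯 ∧ (T ∩ ball 0 R).Nonempty) :
    0 ≤ ∑ T ∈ M, ∑ i, if g T (poly i) ∈ ball 0 R then 1 / 3 - d i else 0 := by
  set pts : Finset Plane :=
    ((M ×ˢ Finset.univ).image fun x => g x.1 (poly x.2)).filter (· ∈ ball 0 R)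
  have hmem : ∀ T ∈ 𝒯, ∀ i, g T (poly i) ∈ T := by
    intro T hT i
    have := mem_image_of_mem (g T) (poly.vertex_mem_region i)
    rwa [← hg T hT] at this
  have hterm : ∀ T ∈ M, ∀ i : Fin n, (if g T (poly i) ∈ ball 0 R then 1 / 3 - d i else 0)
      = ∑ p ∈ pts, if g T (poly i) = p then 1 / 3 - d i else 0 := by
    intro T hT i
    rw [Finset.sum_ite_eq]
    refine if_congr ?_ rfl rfl
    rw [Finset.mem_filter]
    exact (and_iff_right (Finset.mem_image.2
      ⟨(T, i), Finset.mem_product.2 ⟨hT, Finset.mem_univ i⟩, rfl⟩)).symm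
  rw [Finset.sum_congr rfl fun T hT => (Finset.sum_congr rfl fun i _ => hterm T hT i).trans
    Finset.sum_comm, Finset.sum_comm]
  refine Finset.sum_nonneg fun p hp => ?_
  have hpR : p ∈ ball 0 R := (Finset.mem_filter.1 hp).2
  -- Since `p` is in the disk, every tile through `p` meets the disk and is counted in `M`.
  have hF : ∀ T, T ∈ M.filter (p ∈ ·) ↔ T ∈ 𝒯 ∧ p ∈ T := by
    intro T
    rw [Finset.mem_filter, hM]
    exact ⟨fun h => ⟨h.1.1, h.2⟩, fun h => ⟨⟨h.1, p, h.2, hpR⟩, h.2⟩⟩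
  have := h.local_sum_nonneg hpoly hd hd2 hg hF
  rw [Finset.sum_filter] at this
  refine this.trans_eq (Finset.sum_congr rfl fun T hT => ?_)
  split_ifs with hpT
  · rfl
  · refine (Finset.sum_eq_zero fun i _ => if_neg ?_).symm
    rintro rfl
    exact hpT (hmem T ((hM T).1 hT).1 i)

/-- The tiles that lie in a disk number at most `2 * n` times the tiles that cross its boundary. -/
lemma IsTessellation.card_le (hpoly : IsConvexPolygon poly) (hn : 7 ≤ n)
    (h : IsTessellation poly.region 𝒯) {R : ℝ} {A M : Finset (Set Plane)}
    (hM : ∀ T, T ∈ M ↔ T ∈ 𝒯 ∧ (T ∩ ball 0 R).Nonempty)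
    (hA : ∀ T, T ∈ A ↔ T ∈ 𝒯 ∧ T ⊆ ball 0 R) :
    (A.card : ℝ) ≤ 2 * n * (M.card - A.card) := by
  classical
  obtain ⟨d, hd, hd0, hd2, hds⟩ := hpoly.exists_density
  choose! g hg using h.isCopyOf
  have hmem : ∀ T ∈ 𝒯, ∀ i, g T (poly i) ∈ T := by
    intro T hT i
    have := mem_image_of_mem (g T) (poly.vertex_mem_region i)
    rwa [← hg T hT] at this
  have hAM : A ⊆ M := by
    intro T hT
    rw [hA] at hT
    have hx := hmem T hT.1 ⟨0, by omega⟩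
    exact (hM T).2 ⟨hT.1, _, hx, hT.2 hx⟩
  have h0 := h.sum_ball_nonneg hpoly hd hd2 hg hM
  have hn' : (7 : ℝ) ≤ n := by exact_mod_cast hn
  -- All `n` corners count here, giving `n / 3 - (n / 2 - 1) = 1 - n / 6`; this is where `7 ≤ n`
  -- makes the bound negative.
  have hin : ∀ T ∈ A,
      (∑ i, if g T (poly i) ∈ ball 0 R then 1 / 3 - d i else 0) ≤ -(1 / 6) := by
    intro T hT
    rw [hA] at hT
    rw [Finset.sum_congr rfl fun i _ => if_pos (hT.2 (hmem T hT.1 i)), Finset.sum_sub_distrib,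
      Finset.sum_const, Finset.card_univ, Fintype.card_fin, nsmul_eq_mul]
    linarith
  have hout : ∀ T ∈ M \ A,
      (∑ i, if g T (poly i) ∈ ball 0 R then 1 / 3 - d i else 0) ≤ (n : ℝ) / 3 := by
    intro T _
    have : ∑ _i : Fin n, (1 / 3 : ℝ) = n / 3 := by
      rw [Finset.sum_const, Finset.card_univ, Fintype.card_fin, nsmul_eq_mul]; ring
    rw [← this]
    refine Finset.sum_le_sum fun i _ => ?_
    split_ifs
    · linarith [hd0 i]
    · norm_num
  rw [← Finset.sum_sdiff hAM] at h0
  have h1 := Finset.sum_le_card_nsmul _ _ _ hin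
  have h2 := Finset.sum_le_card_nsmul _ _ _ hout
  rw [nsmul_eq_mul] at h1 h2
  rw [Finset.cast_card_sdiff hAM] at h2
  linarith

end Counting

/-! ### Contradiction by comparing areas. -/

theorem mainTheorem5 (n : ℕ) (hn : 7 ≤ n) (poly : Polygon Plane n)
    (hpoly : IsConvexPolygon poly) : ¬ AdmitsTessellation poly.region := by
  rintro ⟨𝒯, h⟩
  have hc := poly.convex_region
  have hk := poly.isCompact_region
  have hi := hpoly.interior_nonempty
  set D : ℝ := diam poly.region + 1 with hD
  have hDpos : 0 < D := by have := diam_nonneg (s := poly.region); linarith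
  have hn0 : (0 : ℝ) ≤ n := n.cast_nonneg
  -- This radius makes `(2 * n + 1) * (R - D) ^ 2` exceed `2 * n * (R + D) ^ 2` by exactly `D ^ 2`.
  set R : ℝ := (8 * n + 2) * D with hRdef
  have hRD : D ≤ R := by rw [hRdef]; nlinarith
  have hfin := h.finite_meeting hc hk hi 0 R
  have hfin' : {T ∈ 𝒯 | T ⊆ ball 0 R}.Finite := by
    refine hfin.subset fun T hT => ⟨hT.1, ?_⟩
    rw [inter_eq_left.2 hT.2]
    obtain ⟨g, rfl⟩ := h.isCopyOf T hT.1
    exact (hi.mono interior_subset).image g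
  have hM : ∀ T, T ∈ hfin.toFinset ↔ T ∈ 𝒯 ∧ (T ∩ ball 0 R).Nonempty := fun T =>
    hfin.mem_toFinset
  have hA : ∀ T, T ∈ hfin'.toFinset ↔ T ∈ 𝒯 ∧ T ⊆ ball 0 R := fun T => hfin'.mem_toFinset
  generalize hfin.toFinset = M at hM
  generalize hfin'.toFinset = A at hA
  have hcard := h.card_le hpoly hn hM hA
  have hup := h.card_mul_le hc hk (fun T hT => ((hM T).1 hT).1) (R := R + D) fun T hT =>
    (h.isCopyOf T ((hM T).1 hT).1).subset_ball hk ((hM T).1 hT).2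
  -- A tile that meets the disk of radius `R - D` lies inside the disk of radius `R`, so the inner
  -- tiles cover the smaller disk.
  have hlow := h.le_card_mul (fun T hT => ((hA T).1 hT).1) hk (B := ball 0 (R - D)) fun x hx => by
    obtain ⟨T, hT, hxT⟩ := h.exists_mem x
    have hsub := (h.isCopyOf T hT).subset_ball hk ⟨x, hxT, hx⟩
    rw [← hD, sub_add_cancel] at hsub
    exact ⟨T, (hA T).2 ⟨hT, hsub⟩, hxT⟩
  rw [volume_real_ball _ (by linarith)] at hup hlow
  have hv := volume_real_ball_pos (0 : Plane) one_pos
  have ha : 0 ≤ volume.real poly.region := measureReal_nonneg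
  -- The counting bound reads `(2 * n + 1) * A.card ≤ 2 * n * M.card`; the area bounds then
  -- eliminate both cardinalities.
  have h1 := mul_le_mul_of_nonneg_right hcard ha
  have h2 := mul_le_mul_of_nonneg_left hup (by positivity : (0 : ℝ) ≤ 2 * n)
  have h3 := mul_le_mul_of_nonneg_left hlow (by positivity : (0 : ℝ) ≤ 2 * n + 1)
  have h4 : (2 * n + 1) * (R - D) ^ 2 * volume.real (ball (0 : Plane) 1)
      ≤ 2 * n * (R + D) ^ 2 * volume.real (ball (0 : Plane) 1) := by linarith
  have h5 := le_of_mul_le_mul_right h4 hv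
  have h6 : (2 * n + 1) * (R - D) ^ 2 - 2 * n * (R + D) ^ 2 = D ^ 2 := by rw [hRdef]; ring
  have : 0 < D ^ 2 := by positivity
  linarith
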